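/- Conventions. All spaces, maps and homotopies are pointed. $X$ is a connected CW complex of finite type (finitely many cells in each dimension) whose basepoint is a vertex, and $X^n$ is its $n$-skeleton. A map $f\colon X\to Y$ is a phantom map if $f|_{X^n}$ is null homotopic for every $n$; $\mathrm{Ph}(X,Y)$ is the set of homotopy classes of phantom maps $X\to Y$, and $\mathrm{Ph}(X,Y)=*$ means that it contains only the class of the constant map. For a map $\varphi\colon B\to Y$, a map $f\colon X\to Y$ is a phantom map relative to $\varphi$ if for every $n$ there is $g_n\colon X^n\to B$ with $\varphi\circ g_n\simeq f|_{X^n}$; $\mathrm{Ph}(X,\varphi)$ is the set of homotopy classes of such maps. It is called trivial if every element of $\mathrm{Ph}(X,\varphi)$ is the class of $\varphi\circ g$ for some $g\colon X\to B$. The pair $F\xrightarrow{i}E\xrightarrow{p}B$ is a homotopy fibration if there is a (pointed) homotopy equivalence $e$ from $F$ to the homotopy fiber of $p$ such that the composite of $e$ with the projection to $E$ is homotopic to $i$; a sequence of maps is a homotopy fibration sequence if any two consecutive maps form a homotopy fibration. $\Sigma X$ is the reduced suspension, with any structure of CW complex of finite type with the basepoint a vertex. (1) Let $B\xrightarrow{\varphi}Y\xrightarrow{\alpha}V\xrightarrow{\beta}W$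 be a homotopy fibration sequence such that either $\beta$ is null homotopic or $\mathrm{Ph}(X,W)=*$. Then $\mathrm{Ph}(X,\varphi)$ is trivial if and only if $\mathrm{Ph}(X,V)=*$. (2) Let $F\xrightarrow{j}B\xrightarrow{\varphi}Y$ be a homotopy fibration such that either $j$ is null homotopic or $\mathrm{Ph}(X,B)=*$. Then $\mathrm{Ph}(\Sigma X,\varphi)$ is trivial if and only if $\mathrm{Ph}(X,F)=*$. -/

import Mathlib

open scoped unitInterval

noncomputable section

/-- A pointed topological space. -/
structure PtdSpace where
  carrier : Type*
  [top : TopologicalSpace carrier]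
  pt : carrier

namespace PtdSpace

instance : CoeSort PtdSpace (Type _) := ⟨PtdSpace.carrier⟩

instance (X : PtdSpace) : TopologicalSpace X := X.top

/-- Basepoint preserving continuous maps. -/
structure Map (X Y : PtdSpace) where
  toFun : C(X, Y)
  map_pt : toFun X.pt = Y.pt

namespace Map

def id (X : PtdSpace) : Map X X := ⟨ContinuousMap.id X, rfl⟩

def comp {X Y Z : PtdSpace} (g : Map Y Z) (f : Map X Y) : Map X Z :=
  ⟨g.toFun.comp f.toFun, by simp [f.map_pt, g.map_pt]⟩

/-- The constant map at the basepoint. -/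
def const (X Y : PtdSpace) : Map X Y := ⟨ContinuousMap.const X Y.pt, rfl⟩

/-- Pointed homotopy: a homotopy that is stationary at the basepoint. -/
def Homotopic {X Y : PtdSpace} (f g : Map X Y) : Prop :=
  f.toFun.HomotopicRel g.toFun {X.pt}

/-- Pointed null homotopic maps. -/
def NullHomotopic {X Y : PtdSpace} (f : Map X Y) : Prop :=
  f.Homotopic (const X Y)

/-- `f : X → Y` lifts through `φ : B → Y`, up to (pointed) homotopy. -/
def LiftsUpToHomotopy {X B Y : PtdSpace} (f : Map X Y) (φ : Map B Y) : Prop :=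
  ∃ g : Map X B, (φ.comp g).Homotopic f

/-- Pointed homotopy equivalences. -/
def IsHomotopyEquiv {X Y : PtdSpace} (f : Map X Y) : Prop :=
  ∃ g : Map Y X, (g.comp f).Homotopic (id X) ∧ (f.comp g).Homotopic (id Y)

/-- The relation of pointed homotopy is an equivalence relation. -/
def setoid (X Y : PtdSpace) : Setoid (Map X Y) where
  r := Homotopic
  iseqv := ⟨fun f => ContinuousMap.HomotopicRel.refl f.toFun,
    fun h => ContinuousMap.HomotopicRel.symm h,
    fun h₁ h₂ => ContinuousMap.HomotopicRel.trans h₁ h₂⟩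

end Map

/-- The set `[X, Y]` of pointed homotopy classes of pointed maps. -/
def HtpyClass (X Y : PtdSpace) : Type _ := Quotient (Map.setoid X Y)

/-- The pointed homotopy class of a pointed map. -/
def Map.cls {X Y : PtdSpace} (f : Map X Y) : HtpyClass X Y :=
  Quotient.mk (Map.setoid X Y) f

/-- The homotopy fiber of `p : E → B`: pairs `(e, γ)` of a point `e` of `E` and a path `γ` in `B`
from `p e` to the basepoint of `B`. -/
def hofiber {E B : PtdSpace} (p : Map E B) : PtdSpace where
  carrier := {q : E × C(I, B) // q.2 0 = p.toFun q.1 ∧ q.2 1 = B.pt}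
  pt := ⟨(E.pt, ContinuousMap.const I B.pt), p.map_pt.symm, rfl⟩

/-- The projection of the homotopy fiber of `p : E → B` to `E`. -/
def hofiberProj {E B : PtdSpace} (p : Map E B) : Map (hofiber p) E where
  toFun := ⟨fun q => q.1.1, continuous_fst.comp continuous_subtype_val⟩
  map_pt := rfl

/-- `F → E → B` is a homotopy fibration: up to homotopy, `i : F → E` is identified with the
projection of the homotopy fiber of `p` to `E` by a homotopy equivalence. -/
def IsHomotopyFibration {F E B : PtdSpace} (i : Map F E) (p : Map E B) : Prop :=
  ∃ e : Map F (hofiber p), e.IsHomotopyEquiv ∧ ((hofiberProj p).comp e).Homotopic i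

/-- The part of `X × [0, 1]` collapsed to the basepoint in the reduced suspension of `X`. -/
def suspBase (X : PtdSpace) : Set (X × I) := {p | p.1 = X.pt ∨ p.2 = 0 ∨ p.2 = 1}

def suspSetoid (X : PtdSpace) : Setoid (X × I) where
  r p q := p = q ∨ (p ∈ suspBase X ∧ q ∈ suspBase X)
  iseqv := ⟨fun _ => Or.inl rfl,
    fun h => h.imp Eq.symm And.symm,
    by
      rintro p q r (rfl | ⟨hp, hq⟩) (rfl | ⟨hq', hr⟩)
      · exact Or.inl rfl
      · exact Or.inr ⟨hq', hr⟩
      · exact Or.inr ⟨hp, hq⟩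
      · exact Or.inr ⟨hp, hr⟩⟩

/-- The reduced suspension of a pointed space. -/
def susp (X : PtdSpace) : PtdSpace where
  carrier := Quotient (suspSetoid X)
  pt := Quotient.mk (suspSetoid X) (X.pt, 0)

/-- A structure of connected CW complex of finite type on the pointed space `X`, with the basepoint
a vertex. -/
structure CWStructure (X : PtdSpace) where
  t2 : T2Space X
  connected : ConnectedSpace X
  cw : Topology.CWComplex (Set.univ : Set X)
  finiteType : Topology.CWComplex.FiniteType (Set.univ : Set X)
  pt_mem : X.pt ∈ Topology.CWComplex.skeleton (Set.univ : Set X) 0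

namespace CWStructure

variable {X : PtdSpace}

/-- The underlying set of the `n`-skeleton. -/
def skelSet (K : CWStructure X) (n : ℕ) : Set X :=
  letI := K.t2
  letI := K.cw
  (Topology.CWComplex.skeleton (Set.univ : Set X) (n : ℕ∞) : Set X)

theorem pt_mem_skelSet (K : CWStructure X) (n : ℕ) : X.pt ∈ K.skelSet n := by
  let := K.t2
  let := K.cw
  exact Topology.CWComplex.skeleton_mono (C := (Set.univ : Set X)) (zero_le (a := (n : ℕ∞))) K.pt_mem

/-- The `n`-skeleton, as a pointed space. -/
def skel (K : CWStructure X) (n : ℕ) : PtdSpace where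
  carrier := K.skelSet n
  pt := ⟨X.pt, K.pt_mem_skelSet n⟩

/-- The inclusion of the `n`-skeleton. -/
def incl (K : CWStructure X) (n : ℕ) : Map (K.skel n) X where
  toFun := ⟨Subtype.val, continuous_subtype_val⟩
  map_pt := rfl

/-- `f : X → Y` is an (absolute) phantom map: its restriction to every finite dimensional skeleton
of `X` is null homotopic. -/
def IsPhantom (K : CWStructure X) {Y : PtdSpace} (f : Map X Y) : Prop :=
  ∀ n : ℕ, (f.comp (K.incl n)).NullHomotopic

/-- `f : X → Y` is a phantom map relative to `φ : B → Y`: its restriction to every finite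
dimensional skeleton of `X` lifts through `φ`, up to homotopy. -/
def IsRelPhantom (K : CWStructure X) {B Y : PtdSpace} (φ : Map B Y) (f : Map X Y) : Prop :=
  ∀ n : ℕ, (f.comp (K.incl n)).LiftsUpToHomotopy φ

/-- `Ph(X, Y)`: the set of homotopy classes of phantom maps from `X` to `Y`. -/
def Ph (K : CWStructure X) (Y : PtdSpace) : Set (HtpyClass X Y) :=
  {c | ∃ f : Map X Y, K.IsPhantom f ∧ f.cls = c}

/-- `Ph(X, φ)`: the set of homotopy classes of phantom maps from `X` to `Y` relative to `φ`. -/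
def RelPh (K : CWStructure X) {B Y : PtdSpace} (φ : Map B Y) : Set (HtpyClass X Y) :=
  {c | ∃ f : Map X Y, K.IsRelPhantom φ f ∧ f.cls = c}

/-- `Ph(X, Y) = *`: the class of the constant map is the only element of `Ph(X, Y)`. -/
def PhEqPoint (K : CWStructure X) (Y : PtdSpace) : Prop :=
  K.Ph Y = {(Map.const X Y).cls}

/-- `Ph(X, φ)` is trivial: each of its elements is represented by a map `X → Y` that lifts
through `φ`, up to homotopy. -/
def RelPhTrivial (K : CWStructure X) {B Y : PtdSpace} (φ : Map B Y) : Prop :=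
  ∀ c ∈ K.RelPh φ, ∃ f : Map X Y, f.LiftsUpToHomotopy φ ∧ f.cls = c

end CWStructure

end PtdSpace

end

/-!
Exactness of `[Z, F] → [Z, E] → [Z, B]` along a homotopy fibration `F → E → B`, applied to `X` and
to its skeleta, turns relative phantom maps into phantom maps: `f` is phantom relative to `φ`
exactly when `α ∘ f` is phantom, and `f` lifts through `φ` exactly when `α ∘ f` is null homotopic.
The hypothesis on `β` and `W` makes every phantom map to `V` factor through `α`. For the second
part, the same argument applies to the Puppe sequence `ΩB → ΩY → F → B`, because a map
`ΣX → Y` is phantom relative to `φ` exactly when its adjoint `X → ΩY` is phantom relative to `Ωφ`: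
by compactness, the suspensions of the skeleta of `X` and the skeleta of `ΣX` are cofinal in each
other.
-/

open Set Topology

section LocallyFinite

variable {ι T T' : Type*} [TopologicalSpace T] [TopologicalSpace T']

theorem locallyFinite_of_isClosed_biUnion {f : ι → Set T} (hfin : ∀ x, {i | x ∈ f i}.Finite)
    (hclosed : ∀ s : Set ι, IsClosed (⋃ i ∈ s, f i)) : LocallyFinite f := by
  intro x
  refine ⟨(⋃ i ∈ {i | x ∉ f i}, f i)ᶜ, (hclosed _).isOpen_compl.mem_nhds (by simp),
    (hfin x).subset ?_⟩
  rintro i ⟨y, hy, hyx⟩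
  by_contra hx
  exact hyx (mem_biUnion hx hy)

theorem locallyFinite_of_isQuotientMap {q : T → T'} (hq : IsQuotientMap q) {f : ι → Set T'}
    (hf : LocallyFinite fun i => q ⁻¹' f i) (hclosed : ∀ i, IsClosed (q ⁻¹' f i)) :
    LocallyFinite f := by
  refine locallyFinite_of_isClosed_biUnion (hq.surjective.forall.2 hf.point_finite) fun s => ?_
  rw [← hq.isClosed_preimage, preimage_iUnion₂, biUnion_eq_iUnion]
  exact (hf.comp_injective Subtype.val_injective).isClosed_iUnion fun i => hclosed i

theorem exists_subset_of_isCompact_of_locallyFinite [Infinite ι] {S : ι → Set T}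
    (hS : ∀ y : ι → T, (∀ i, y i ∉ S i) → LocallyFinite fun i => {y i}) {C : Set T}
    (hC : IsCompact C) : ∃ i, C ⊆ S i := by
  by_contra! h
  simp only [not_subset] at h
  choose y hyC hyS using h
  refine infinite_univ (((hS y hyS).finite_nonempty_inter_compact hC).subset fun i _ => ?_)
  exact ⟨y i, rfl, hyC i⟩

end LocallyFinite

/-- Two maps `a, b : T × I → Y` that agree on `T × {0}`, glued to one map on `T × ℝ` that is `b`
on `T × [0, 1]` and the reverse of `a` on `T × [-1, 0]`. -/
noncomputable def spliceAtZero {T Y : Type*} [TopologicalSpace T] [TopologicalSpace Y]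
    (a b : C(T × I, Y)) (h : ∀ x, a (x, 0) = b (x, 0)) : C(T × ℝ, Y) where
  toFun q := if q.2 ≤ 0 then a (q.1, projIcc 0 1 zero_le_one (-q.2))
    else b (q.1, projIcc 0 1 zero_le_one q.2)
  continuous_toFun := by
    have : Continuous (projIcc (0 : ℝ) 1 zero_le_one) := continuous_projIcc
    refine Continuous.if_le (by fun_prop) (by fun_prop) continuous_snd continuous_const ?_
    rintro ⟨x, r⟩ (rfl : r = 0)
    simpa using h x

section spliceAtZero

variable {T Y : Type*} [TopologicalSpace T] [TopologicalSpace Y] {a b : C(T × I, Y)}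
  (h : ∀ x, a (x, 0) = b (x, 0))

theorem spliceAtZero_neg (x : T) (s : I) : spliceAtZero a b h (x, -s) = a (x, s) := by
  simp [spliceAtZero, s.2.1]

theorem spliceAtZero_coe (x : T) (t : I) : spliceAtZero a b h (x, t) = b (x, t) := by
  rcases t.2.1.eq_or_lt with ht | ht
  · obtain rfl : t = 0 := Subtype.ext ht.symm
    simpa [spliceAtZero] using h x
  · simp [spliceAtZero, ht.not_ge]

theorem spliceAtZero_eq_of_forall_eq {x : T} {y : Y} (ha : ∀ s, a (x, s) = y)
    (hb : ∀ t, b (x, t) = y) (r : ℝ) : spliceAtZero a b h (x, r) = y := by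
  simp [spliceAtZero, ha, hb]

end spliceAtZero

namespace PtdSpace

namespace Map

instance {X Y : PtdSpace} : CoeFun (Map X Y) fun _ => X → Y := ⟨fun f => f.toFun⟩

variable {X Y Z W : PtdSpace}

theorem ext {f g : Map X Y} (h : ∀ x, f x = g x) : f = g := by
  cases f
  cases g
  congr
  exact ContinuousMap.ext h

theorem comp_const (g : Map Y Z) : g.comp (const X Y) = const X Z :=
  ext fun _ => g.map_pt

theorem exists_comp_eq_of_range_subset {i : Map X Y} (hi : IsEmbedding i.toFun) {h : Map Z Y}
    (hr : range h.toFun ⊆ range i.toFun) : ∃ k : Map Z X, i.comp k = h := by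
  choose k hk using fun z => hr (mem_range_self z)
  have hcont : Continuous k :=
    hi.continuous_iff.2 (h.toFun.continuous.congr fun z => (hk z).symm)
  have hpt : k Z.pt = X.pt := hi.injective <| by rw [hk, h.map_pt, i.map_pt]
  exact ⟨⟨⟨k, hcont⟩, hpt⟩, ext hk⟩

theorem cls_eq_cls {f g : Map X Y} : f.cls = g.cls ↔ f.Homotopic g :=
  Quotient.eq (r := setoid X Y)

theorem homotopic_iff {f g : Map X Y} :
    f.Homotopic g ↔ ∃ H : C(I × X, Y), (∀ x, H (0, x) = f x) ∧ (∀ x, H (1, x) = g x) ∧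
      ∀ s, H (s, X.pt) = Y.pt := by
  constructor
  · rintro ⟨H⟩
    exact ⟨H.toContinuousMap, H.map_zero_left, H.map_one_left,
      fun s => (H.eq_fst s rfl).trans f.map_pt⟩
  · rintro ⟨H, h₀, h₁, hpt⟩
    exact ⟨⟨⟨H, h₀, h₁⟩, by rintro s x rfl; exact (hpt s).trans f.map_pt.symm⟩⟩

namespace Homotopic

theorem refl (f : Map X Y) : f.Homotopic f := ContinuousMap.HomotopicRel.refl f.toFun

theorem symm {f g : Map X Y} (h : f.Homotopic g) : g.Homotopic f :=
  ContinuousMap.HomotopicRel.symm h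

theorem trans {f g h : Map X Y} (h₁ : f.Homotopic g) (h₂ : g.Homotopic h) : f.Homotopic h :=
  ContinuousMap.HomotopicRel.trans h₁ h₂

theorem comp_left {f g : Map X Y} (h : f.Homotopic g) (k : Map Y Z) :
    (k.comp f).Homotopic (k.comp g) :=
  ContinuousMap.HomotopicRel.comp_continuousMap h k.toFun

theorem comp_right {f g : Map Y Z} (h : f.Homotopic g) (k : Map X Y) :
    (f.comp k).Homotopic (g.comp k) := by
  obtain ⟨H, h₀, h₁, hpt⟩ := homotopic_iff.1 h
  exact homotopic_iff.2 ⟨H.comp ((ContinuousMap.id I).prodMap k.toFun), fun x => h₀ (k x),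
    fun x => h₁ (k x), fun s => (congrArg (fun y => H (s, y)) k.map_pt).trans (hpt s)⟩

theorem nullHomotopic_iff {f g : Map X Y} (h : f.Homotopic g) :
    f.NullHomotopic ↔ g.NullHomotopic :=
  ⟨h.symm.trans, h.trans⟩

theorem liftsUpToHomotopy_iff {f g : Map X Y} (h : f.Homotopic g) {φ : Map Z Y} :
    f.LiftsUpToHomotopy φ ↔ g.LiftsUpToHomotopy φ :=
  exists_congr fun _ => ⟨fun hk => hk.trans h, fun hk => hk.trans h.symm⟩

theorem liftsUpToHomotopy_iff_right {φ ψ : Map Y Z} (h : φ.Homotopic ψ) {f : Map X Z} :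
    f.LiftsUpToHomotopy φ ↔ f.LiftsUpToHomotopy ψ :=
  exists_congr fun k => ⟨(h.symm.comp_right k).trans, (h.comp_right k).trans⟩

end Homotopic

theorem NullHomotopic.comp_left {f : Map X Y} (h : f.NullHomotopic) (k : Map Y Z) :
    (k.comp f).NullHomotopic := by
  rw [NullHomotopic, ← comp_const k]
  exact Homotopic.comp_left h k

theorem NullHomotopic.comp_right {f : Map Y Z} (h : f.NullHomotopic) (k : Map X Y) :
    (f.comp k).NullHomotopic :=
  Homotopic.comp_right h k

theorem LiftsUpToHomotopy.comp_right {f : Map X Y} {φ : Map W Y} (h : f.LiftsUpToHomotopy φ)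
    (k : Map Z X) : (f.comp k).LiftsUpToHomotopy φ := by
  obtain ⟨g, hg⟩ := h
  exact ⟨g.comp k, hg.comp_right k⟩

namespace IsHomotopyEquiv

variable {e : Map X Y} (he : e.IsHomotopyEquiv)
include he

theorem homotopic_comp_iff {f g : Map Z X} :
    (e.comp f).Homotopic (e.comp g) ↔ f.Homotopic g := by
  obtain ⟨e', he'e, -⟩ := he
  refine ⟨fun h => ?_, fun h => h.comp_left e⟩
  exact ((he'e.symm.comp_right f).trans (h.comp_left e')).trans (he'e.comp_right g)

theorem nullHomotopic_comp_iff {f : Map Z X} : (e.comp f).NullHomotopic ↔ f.NullHomotopic := by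
  rw [NullHomotopic, ← comp_const, he.homotopic_comp_iff, NullHomotopic]

theorem liftsUpToHomotopy_comp_iff {f : Map Z X} {φ : Map W X} :
    (e.comp f).LiftsUpToHomotopy (e.comp φ) ↔ f.LiftsUpToHomotopy φ :=
  exists_congr fun k => he.homotopic_comp_iff (f := φ.comp k)

theorem liftsUpToHomotopy_comp_right_iff {f : Map Z W} {φ : Map Y W} :
    f.LiftsUpToHomotopy (φ.comp e) ↔ f.LiftsUpToHomotopy φ := by
  obtain ⟨e', -, hee'⟩ := he
  constructor
  · rintro ⟨g, hg⟩
    exact ⟨e.comp g, hg⟩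
  · rintro ⟨g, hg⟩
    exact ⟨e'.comp g, ((hee'.comp_right g).comp_left φ).trans hg⟩

end IsHomotopyEquiv

end Map

open Map

/-- Exactness of `[Z, F] → [Z, E] → [Z, B]` at `[Z, E]`. -/
def IsExactAt (Z : PtdSpace) {F E B : PtdSpace} (i : Map F E) (p : Map E B) : Prop :=
  ∀ f : Map Z E, (p.comp f).NullHomotopic ↔ f.LiftsUpToHomotopy i

namespace IsExactAt

variable {Z F E B E' : PtdSpace} {i : Map F E} {p : Map E B}

theorem congr_left {i' : Map F E} (h : IsExactAt Z i p) (hi : i.Homotopic i') :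
    IsExactAt Z i' p :=
  fun f => (h f).trans hi.liftsUpToHomotopy_iff_right

theorem congr_right {p' : Map E B} (h : IsExactAt Z i p) (hp : p.Homotopic p') :
    IsExactAt Z i p' :=
  fun f => (hp.comp_right f).nullHomotopic_iff.symm.trans (h f)

theorem comp_left {e : Map E' F} (h : IsExactAt Z i p) (he : e.IsHomotopyEquiv) :
    IsExactAt Z (i.comp e) p :=
  fun f => (h f).trans he.liftsUpToHomotopy_comp_right_iff.symm

theorem comp_right {e : Map B E'} (h : IsExactAt Z i p) (he : e.IsHomotopyEquiv) :
    IsExactAt Z i (e.comp p) :=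
  fun f => (he.nullHomotopic_comp_iff (f := p.comp f)).trans (h f)

theorem of_comp_isHomotopyEquiv {p : Map E' B} {e : Map E E'} (h : IsExactAt Z i (p.comp e))
    (he : e.IsHomotopyEquiv) : IsExactAt Z (e.comp i) p := by
  obtain ⟨e', -, hee'⟩ := id he
  intro f
  have hf : (e.comp (e'.comp f)).Homotopic f := hee'.comp_right f
  rw [← (hf.comp_left p).nullHomotopic_iff, ← hf.liftsUpToHomotopy_iff,
    he.liftsUpToHomotopy_comp_iff]
  exact h (e'.comp f)

end IsExactAt

section hofiber

variable {E B Z : PtdSpace}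

/-- The value of the path component of a point of the homotopy fiber. -/
def hofiberEval (p : Map E B) : C(hofiber p × I, B) where
  toFun q := q.1.1.2 q.2
  continuous_toFun := by
    have : Continuous fun q : hofiber p => q.1.2 := continuous_snd.comp continuous_subtype_val
    fun_prop

/-- The map to the homotopy fiber of `p` given by a map to `E` and a family of paths in `B`. -/
def toHofiber {T : Type*} [TopologicalSpace T] {p : Map E B} (b : C(T, E)) (G : C(T × I, B))
    (h₀ : ∀ x, G (x, 0) = p (b x)) (h₁ : ∀ x, G (x, 1) = B.pt) : C(T, hofiber p) where
  toFun x := ⟨(b x, G.curry x), h₀ x, h₁ x⟩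
  continuous_toFun := (b.continuous.prodMk G.curry.continuous).subtype_mk _

theorem hofiber_ext {p : Map E B} {x y : hofiber p} (hpt : x.1.1 = y.1.1)
    (hpath : ∀ t, x.1.2 t = y.1.2 t) : x = y :=
  Subtype.ext (Prod.ext hpt (ContinuousMap.ext hpath))

theorem isExactAt_hofiberProj (p : Map E B) : IsExactAt Z (hofiberProj p) p := by
  intro f
  constructor
  · intro hf
    obtain ⟨H, h₀, h₁, hpt⟩ := homotopic_iff.1 hf
    exact ⟨⟨toHofiber f.toFun (H.comp .prodSwap) h₀ h₁, hofiber_ext f.map_pt hpt⟩,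
      Homotopic.refl f⟩
  · rintro ⟨g, hg⟩
    refine (hg.comp_left p).nullHomotopic_iff.1 (homotopic_iff.2
      ⟨(hofiberEval p).comp (.comp (g.toFun.prodMap (.id I)) .prodSwap), fun z => (g z).2.1,
        fun z => (g z).2.2, fun s => ?_⟩)
    change hofiberEval p (g Z.pt, s) = B.pt
    rw [g.map_pt]
    rfl

theorem exists_homotopic_hofiberProj_comp_eq {p : Map E B} {g : Map Z (hofiber p)} {k : Map Z E}
    (h : ((hofiberProj p).comp g).Homotopic k) :
    ∃ g', g.Homotopic g' ∧ (hofiberProj p).comp g' = k := by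
  obtain ⟨H, h₀, h₁, hpt⟩ := homotopic_iff.1 h
  let γ := spliceAtZero (p.toFun.comp (H.comp .prodSwap))
    ((hofiberEval p).comp (g.toFun.prodMap (.id I)))
    fun z => (congrArg p (h₀ z)).trans (g z).2.1.symm
  have γ_neg (z : Z) (s : I) : γ (z, -s) = p (H (s, z)) := spliceAtZero_neg _ z s
  have γ_coe (z : Z) (t : I) : γ (z, t) = (g z).1.2 t := spliceAtZero_coe _ z t
  have γ_pt (r : ℝ) : γ (Z.pt, r) = B.pt :=
    spliceAtZero_eq_of_forall_eq _ (fun s => (congrArg p (hpt s)).trans p.map_pt)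
      (fun t => congrArg (fun q : hofiber p => q.1.2 t) g.map_pt) r
  -- At time `s` the path runs along `γ` from `-s` to `1`.
  let G : C((I × Z) × I, B) := γ.comp ⟨fun q => (q.1.2, q.2 - q.1.1 * (1 - q.2)), by fun_prop⟩
  have G_zero (q : I × Z) : G (q, 0) = p (H q) := by
    simpa [G] using γ_neg q.2 q.1
  have G_one (q : I × Z) : G (q, 1) = B.pt := by
    simpa [G] using (γ_coe q.2 1).trans (g q.2).2.2
  let L : C(I × Z, hofiber p) := toHofiber H G G_zero G_one
  have L_pt (s : I) : L (s, Z.pt) = (hofiber p).pt := hofiber_ext (hpt s) fun t => γ_pt _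
  refine ⟨⟨L.comp (.prodMk (.const Z 1) (.id Z)), L_pt 1⟩, ?_, Map.ext h₁⟩
  refine homotopic_iff.2 ⟨L, fun z => hofiber_ext (h₀ z) fun t => ?_, fun _ => rfl, L_pt⟩
  change γ (z, t - (0 : I) * (1 - t)) = _
  simpa using γ_coe z t

theorem IsHomotopyFibration.isExactAt {F : PtdSpace} {i : Map F E} {p : Map E B}
    (h : IsHomotopyFibration i p) : IsExactAt Z i p := by
  obtain ⟨e, he, hi⟩ := h
  exact ((isExactAt_hofiberProj p).comp_left he).congr_left hi

end hofiber

/-- The loop space of a pointed space. -/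
def loop (Y : PtdSpace) : PtdSpace where
  carrier := {γ : C(I, Y) // γ 0 = Y.pt ∧ γ 1 = Y.pt}
  pt := ⟨ContinuousMap.const I Y.pt, rfl, rfl⟩

section loop

variable {B Y Z : PtdSpace}

/-- The value of a loop at a time. -/
def loopEval (Y : PtdSpace) : C(loop Y × I, Y) where
  toFun q := q.1.1 q.2
  continuous_toFun := by
    have : Continuous fun γ : loop Y => γ.1 := continuous_subtype_val
    fun_prop

/-- The map to the loop space given by a family of loops. -/
def toLoop {T : Type*} [TopologicalSpace T] (G : C(T × I, Y)) (h₀ : ∀ x, G (x, 0) = Y.pt)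
    (h₁ : ∀ x, G (x, 1) = Y.pt) : C(T, loop Y) where
  toFun x := ⟨G.curry x, h₀ x, h₁ x⟩
  continuous_toFun := G.curry.continuous.subtype_mk _

theorem loop_ext {γ δ : loop Y} (h : ∀ t, γ.1 t = δ.1 t) : γ = δ :=
  Subtype.ext (ContinuousMap.ext h)

theorem loop_apply_pt (f : Map Z (loop Y)) (t : I) : (f Z.pt).1 t = Y.pt := by
  rw [f.map_pt]
  rfl

theorem homotopic_of_loop_family {f g : Map Z (loop Y)} (G : C((I × Z) × I, Y))
    (h₀ : ∀ z t, G ((0, z), t) = (f z).1 t) (h₁ : ∀ z t, G ((1, z), t) = (g z).1 t)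
    (hpt : ∀ s t, G ((s, Z.pt), t) = Y.pt) (hleft : ∀ q, G (q, 0) = Y.pt)
    (hright : ∀ q, G (q, 1) = Y.pt) : f.Homotopic g :=
  homotopic_iff.2 ⟨toLoop G hleft hright, fun z => loop_ext (h₀ z), fun z => loop_ext (h₁ z),
    fun s => loop_ext (hpt s)⟩

theorem homotopic_of_square {f g : Map Z (loop Y)} (Γ : C((I × Z) × I, Y))
    (hf : ∀ z t, Γ ((0, z), t) = (f z).1 t) (hg : ∀ z s, Γ ((s, z), 0) = (g z).1 s)
    (hf' : ∀ z t, Γ ((1, z), t) = Y.pt) (hg' : ∀ z s, Γ ((s, z), 1) = Y.pt)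
    (hpt : ∀ s t, Γ ((s, Z.pt), t) = Y.pt) : f.Homotopic g := by
  have corner (z : Z) : Γ ((0, z), 0) = Y.pt := (hf z 0).trans (f z).2.1
  let diagonal : Map Z (loop Y) :=
    ⟨toLoop (Γ.comp ⟨fun q => ((q.2, q.1), q.2), by fun_prop⟩) corner fun z => hf' z 1,
      loop_ext fun t => hpt t t⟩
  have f_diagonal : f.Homotopic diagonal :=
    homotopic_of_loop_family (Γ.comp ⟨fun q => ((q.1.1 * q.2, q.1.2), q.2), by fun_prop⟩)
      (by simpa using hf) (fun z t => congrArg (fun s => Γ ((s, z), t)) (one_mul t))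
      (fun _ _ => hpt _ _) (by simpa using corner) (fun _ => hg' _ _)
  have g_diagonal : g.Homotopic diagonal :=
    homotopic_of_loop_family (Γ.comp ⟨fun q => ((q.2, q.1.2), q.1.1 * q.2), by fun_prop⟩)
      (by simpa using hg) (fun z t => congrArg (fun s => Γ ((t, z), s)) (one_mul t))
      (fun _ _ => hpt _ _) (by simpa using corner) (fun _ => hf' _ _)
  exact f_diagonal.trans g_diagonal.symm

/-- The map `Ωφ` of loop spaces induced by a pointed map `φ`. -/
def loopMap (φ : Map B Y) : Map (loop B) (loop Y) where
  toFun := toLoop (φ.toFun.comp (loopEval B)) (fun β => (congrArg φ β.2.1).trans φ.map_pt)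
    fun β => (congrArg φ β.2.2).trans φ.map_pt
  map_pt := loop_ext fun _ => φ.map_pt

/-- The inclusion of the loop space of the base into the homotopy fiber. -/
def loopToHofiber (φ : Map B Y) : Map (loop Y) (hofiber φ) where
  toFun := toHofiber (.const _ B.pt) (loopEval Y) (fun γ => γ.2.1.trans φ.map_pt.symm)
    fun γ => γ.2.2
  map_pt := rfl

variable (φ : Map B Y)

theorem exists_loopToHofiber_comp_eq {φ : Map B Y} {g : Map Z (hofiber φ)}
    (h : (hofiberProj φ).comp g = const Z B) : ∃ k, (loopToHofiber φ).comp k = g := by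
  have hpt (z : Z) : (g z).1.1 = B.pt := congrArg (fun f : Map Z B => f z) h
  refine ⟨⟨toLoop ((hofiberEval φ).comp (g.toFun.prodMap (.id I))) (fun z => ?_)
    fun z => (g z).2.2, loop_ext fun t => ?_⟩,
    Map.ext fun z => hofiber_ext (hpt z).symm fun _ => rfl⟩
  · exact (g z).2.1.trans ((congrArg φ (hpt z)).trans φ.map_pt)
  · exact congrArg (fun q => hofiberEval φ (q, t)) g.map_pt

theorem isExactAt_loopToHofiber : IsExactAt Z (loopToHofiber φ) (hofiberProj φ) := by
  intro g
  constructor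
  · intro hg
    obtain ⟨g', hgg', hg'⟩ := exists_homotopic_hofiberProj_comp_eq hg
    obtain ⟨k, rfl⟩ := exists_loopToHofiber_comp_eq hg'
    exact ⟨k, hgg'.symm⟩
  · rintro ⟨k, hk⟩
    exact hk.symm.comp_left (hofiberProj φ)

theorem loopToHofiber_comp_loopMap_nullHomotopic :
    ((loopToHofiber φ).comp (loopMap φ)).NullHomotopic := by
  -- The null homotopy moves the initial point of the loop `φ ∘ β` along itself.
  let G : C((I × loop B) × I, Y) :=
    φ.toFun.comp ((loopEval B).comp ⟨fun q => (q.1.2, q.1.1 ⊔ q.2), by fun_prop⟩)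
  have φ_apply_one (β : loop B) {s : I} (hs : s = 1) : φ (β.1 s) = Y.pt := by
    rw [hs, β.2.2, φ.map_pt]
  have G_one (q : I × loop B) : G (q, 1) = Y.pt := φ_apply_one q.2 (sup_of_le_right q.1.2.2)
  refine homotopic_iff.2 ⟨toHofiber ((loopEval B).comp .prodSwap) G (fun q => ?_) G_one,
    fun β => hofiber_ext β.2.1 fun t => ?_, fun β => hofiber_ext β.2.2 fun t => ?_,
    fun _ => hofiber_ext rfl fun _ => φ.map_pt⟩
  · exact congrArg (fun s => φ (q.2.1 s)) (sup_of_le_left q.1.2.1)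
  · exact congrArg (fun s => φ (β.1 s)) (sup_of_le_right t.2.1)
  · exact φ_apply_one β (sup_of_le_left t.2.2)

theorem isExactAt_loopMap : IsExactAt Z (loopMap φ) (loopToHofiber φ) := by
  intro f
  constructor
  · intro hf
    obtain ⟨H, h₀, h₁, hpt⟩ := homotopic_iff.1 hf
    let b : C(Z × I, B) := (hofiberProj φ).toFun.comp (H.comp .prodSwap)
    let k : Map Z (loop B) :=
      ⟨toLoop b (fun z => congrArg (hofiberProj φ) (h₀ z)) fun z => congrArg (hofiberProj φ) (h₁ z),
        loop_ext fun s => congrArg (hofiberProj φ) (hpt s)⟩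
    -- The paths `(H (s, z)).1.2` form a square with left edge `f z` and bottom edge `φ ∘ k z`.
    refine ⟨k, .symm (homotopic_of_square ((hofiberEval φ).comp (H.prodMap (.id I)))
      (fun z t => ?_) (fun z s => (H (s, z)).2.1) (fun z t => ?_) (fun z s => (H (s, z)).2.2)
      fun s t => ?_)⟩
    · exact congrArg (fun q => hofiberEval φ (q, t)) (h₀ z)
    · exact congrArg (fun q => hofiberEval φ (q, t)) (h₁ z)
    · exact congrArg (fun q => hofiberEval φ (q, t)) (hpt s)
  · rintro ⟨k, hk⟩
    exact (hk.comp_left (loopToHofiber φ)).nullHomotopic_iff.1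
      ((loopToHofiber_comp_loopMap_nullHomotopic φ).comp_right k)

universe u in
theorem IsHomotopyFibration.exists_connecting_map {F : PtdSpace} {j : Map F B} {φ : Map B Y}
    (h : IsHomotopyFibration j φ) :
    ∃ δ : Map (loop Y) F,
      ∀ Z : PtdSpace.{u}, IsExactAt Z (loopMap φ) δ ∧ IsExactAt Z δ j := by
  obtain ⟨e, ⟨e', he'e, hee'⟩, hj⟩ := h
  have he' : e'.IsHomotopyEquiv := ⟨e, hee', he'e⟩
  have hproj : (hofiberProj φ).Homotopic (j.comp e') :=
    (hee'.symm.comp_left (hofiberProj φ)).trans (hj.comp_right e')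
  exact ⟨e'.comp (loopToHofiber φ), fun Z => ⟨(isExactAt_loopMap φ).comp_right he',
    ((isExactAt_loopToHofiber φ).congr_right hproj).of_comp_isHomotopyEquiv he'⟩⟩

end loop

section susp

variable {X X' B Y : PtdSpace}

/-- The quotient map to the reduced suspension. -/
def suspMk (X : PtdSpace) : C(X × I, susp X) := ⟨Quotient.mk (suspSetoid X), continuous_quot_mk⟩

theorem isQuotientMap_suspMk (X : PtdSpace) : IsQuotientMap (suspMk X) := isQuotientMap_quot_mk

instance [CompactSpace X] : CompactSpace (susp X) :=
  (isQuotientMap_suspMk X).surjective.compactSpace (suspMk X).continuous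

theorem suspMk_eq_suspMk {p q : X × I} :
    suspMk X p = suspMk X q ↔ p = q ∨ (p ∈ suspBase X ∧ q ∈ suspBase X) :=
  Quotient.eq (r := suspSetoid X)

theorem suspMk_eq_pt {p : X × I} (hp : p ∈ suspBase X) : suspMk X p = (susp X).pt :=
  suspMk_eq_suspMk.2 (Or.inr ⟨hp, Or.inl rfl⟩)

theorem suspMk_preimage_singleton {p : X × I} (hp : p ∉ suspBase X) :
    suspMk X ⁻¹' {suspMk X p} = {p} := by
  ext q
  simp [suspMk_eq_suspMk, hp]

/-- The pointed map on the reduced suspension of `X` given by a map on `X × I` that sends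
`suspBase X` to the basepoint. -/
def suspLift (G : C(X × I, Y)) (h : ∀ p ∈ suspBase X, G p = Y.pt) : Map (susp X) Y where
  toFun :=
    { toFun := Quotient.lift G <| by
        rintro p q (rfl | ⟨hp, hq⟩)
        · rfl
        · rw [h p hp, h q hq]
      continuous_toFun := G.continuous.quotient_lift _ }
  map_pt := h _ (Or.inl rfl)

/-- The map `Σf` of reduced suspensions induced by a pointed map `f`. -/
def suspMap (f : Map X Y) : Map (susp X) (susp Y) :=
  suspLift ((suspMk Y).comp (f.toFun.prodMap (.id I))) fun _ hp =>
    suspMk_eq_pt (hp.imp_left fun h => (congrArg f h).trans f.map_pt)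

theorem suspMap_suspMk (f : Map X Y) (x : X) (t : I) :
    suspMap f (suspMk X (x, t)) = suspMk Y (f x, t) := rfl

theorem suspMap_injective {f : Map X Y} (hf : Function.Injective f.toFun) :
    Function.Injective (suspMap f).toFun := by
  have base {z : X} {u : I} (h : (f z, u) ∈ suspBase Y) : (z, u) ∈ suspBase X :=
    h.imp_left fun h => hf ((show f z = Y.pt from h).trans f.map_pt.symm)
  intro a b hab
  obtain ⟨⟨x, s⟩, rfl⟩ := (isQuotientMap_suspMk X).surjective a
  obtain ⟨⟨y, t⟩, rfl⟩ := (isQuotientMap_suspMk X).surjective b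
  rw [suspMap_suspMk, suspMap_suspMk, suspMk_eq_suspMk, Prod.mk.injEq] at hab
  exact suspMk_eq_suspMk.2 (hab.imp (fun h => Prod.ext (hf h.1) h.2) (And.imp base base))

/-- The adjunction between reduced suspensions and loop spaces. -/
def suspLoopEquiv : Map (susp X) Y ≃ Map X (loop Y) where
  toFun f :=
    have hbase {p : X × I} (hp : p ∈ suspBase X) : f (suspMk X p) = Y.pt :=
      (congrArg f (suspMk_eq_pt hp)).trans f.map_pt
    { toFun := toLoop (f.toFun.comp (suspMk X)) (fun _ => hbase (Or.inr (Or.inl rfl)))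
        fun _ => hbase (Or.inr (Or.inr rfl))
      map_pt := loop_ext fun _ => hbase (Or.inl rfl) }
  invFun g := suspLift ((loopEval Y).comp (g.toFun.prodMap (.id I))) <| by
    rintro ⟨x, t⟩ (rfl | rfl | rfl)
    · exact loop_apply_pt g t
    · exact (g x).2.1
    · exact (g x).2.2
  left_inv f := Map.ext ((isQuotientMap_suspMk X).surjective.forall.2 fun _ => rfl)
  right_inv _ := rfl

theorem suspLoopEquiv_comp (φ : Map B Y) (f : Map (susp X) B) :
    suspLoopEquiv (φ.comp f) = (loopMap φ).comp (suspLoopEquiv f) := rfl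

theorem suspLoopEquiv_comp_suspMap (f : Map (susp X) Y) (i : Map X' X) :
    suspLoopEquiv (f.comp (suspMap i)) = (suspLoopEquiv f).comp i := rfl

theorem Map.Homotopic.suspLoopEquiv {f g : Map (susp X) Y} (h : f.Homotopic g) :
    (suspLoopEquiv f).Homotopic (suspLoopEquiv g) := by
  obtain ⟨H, h₀, h₁, hpt⟩ := homotopic_iff.1 h
  have hbase (s : I) {p : X × I} (hp : p ∈ suspBase X) : H (s, suspMk X p) = Y.pt := by
    rw [suspMk_eq_pt hp, hpt]
  exact homotopic_of_loop_family
    (H.comp ⟨fun q => (q.1.1, suspMk X (q.1.2, q.2)), by fun_prop⟩)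
    (fun _ _ => h₀ _) (fun _ _ => h₁ _) (fun s _ => hbase s (Or.inl rfl))
    (fun q => hbase q.1 (Or.inr (Or.inl rfl))) (fun q => hbase q.1 (Or.inr (Or.inr rfl)))

theorem Map.Homotopic.suspLoopEquiv_symm {f g : Map X (loop Y)} (h : f.Homotopic g) :
    (PtdSpace.suspLoopEquiv.symm f).Homotopic (PtdSpace.suspLoopEquiv.symm g) := by
  obtain ⟨H, h₀, h₁, hpt⟩ := homotopic_iff.1 h
  let slice (s : I) : Map X (loop Y) := ⟨H.curry s, hpt s⟩
  have slice_zero : slice 0 = f := Map.ext h₀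
  have slice_one : slice 1 = g := Map.ext h₁
  have hcont : Continuous fun q : I × susp X => PtdSpace.suspLoopEquiv.symm (slice q.1) q.2 :=
    (isQuotientMap_suspMk X).continuous_lift_prod_right <|
      show Continuous fun q : I × (X × I) => loopEval Y (H (q.1, q.2.1), q.2.2) by fun_prop
  refine homotopic_iff.2 ⟨⟨_, hcont⟩, fun x => ?_, fun x => ?_,
    fun s => (PtdSpace.suspLoopEquiv.symm (slice s)).map_pt⟩
  · rw [← slice_zero]
    rfl
  · rw [← slice_one]
    rfl

theorem suspLoopEquiv_homotopic_iff {f g : Map (susp X) Y} :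
    (suspLoopEquiv f).Homotopic (suspLoopEquiv g) ↔ f.Homotopic g :=
  ⟨fun h => by simpa only [Equiv.symm_apply_apply] using h.suspLoopEquiv_symm,
    Homotopic.suspLoopEquiv⟩

theorem suspLoopEquiv_liftsUpToHomotopy_iff {φ : Map B Y} {f : Map (susp X) Y} :
    (suspLoopEquiv f).LiftsUpToHomotopy (loopMap φ) ↔ f.LiftsUpToHomotopy φ := by
  simp only [LiftsUpToHomotopy, suspLoopEquiv.surjective.exists, ← suspLoopEquiv_comp,
    suspLoopEquiv_homotopic_iff]

end susp

namespace CWStructure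

universe u

variable {X : PtdSpace.{u}} (K : CWStructure X)

section Skeleta

theorem skelSet_mono : Monotone K.skelSet := by
  intro m n hmn
  let := K.t2
  let := K.cw
  exact CWComplex.skeleton_mono (C := (univ : Set X)) (by exact_mod_cast hmn)

theorem iUnion_skelSet : ⋃ n, K.skelSet n = univ := by
  let := K.t2
  let := K.cw
  exact CWComplex.iUnion_skeleton_eq_complex (C := (univ : Set X))

theorem isCompact_skelSet (n : ℕ) : IsCompact (K.skelSet n) := by
  let := K.t2
  let := K.cw
  change IsCompact (RelCWComplex.skeletonLT (univ : Set X) ((n : ℕ∞) + 1) : Set X)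
  rw [RelCWComplex.coe_skeletonLT, empty_union]
  have hfin : {m : ℕ | (m : ℕ∞) < (n : ℕ∞) + 1}.Finite :=
    (finite_Iio (n + 1)).subset fun m hm => by exact_mod_cast hm
  refine hfin.isCompact_biUnion fun m _ => ?_
  have := K.finiteType.finite_cell m
  exact isCompact_iUnion fun j => RelCWComplex.isCompact_closedCell

instance (n : ℕ) : CompactSpace (K.skel n) := isCompact_iff_compactSpace.1 (K.isCompact_skelSet n)

theorem finite_setOf_eq {y : ℕ → X} (hy : ∀ n, y n ∉ K.skelSet n) (x : X) :
    {n | x = y n}.Finite := by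
  obtain ⟨m, hm⟩ := mem_iUnion.1 (K.iUnion_skelSet.symm ▸ mem_univ x)
  refine (finite_Iio m).subset ?_
  rintro n rfl
  exact lt_of_not_ge fun hmn => hy n (K.skelSet_mono hmn hm)

theorem locallyFinite_singleton {y : ℕ → X} (hy : ∀ n, y n ∉ K.skelSet n) :
    LocallyFinite fun n => ({y n} : Set X) := by
  let := K.t2
  let := K.cw
  refine locallyFinite_of_isClosed_biUnion (K.finite_setOf_eq hy) fun s => ?_
  rw [CWComplex.closed (univ : Set X) _ (subset_univ _)]
  intro m j
  refine (((finite_Iio m).image y).subset ?_).isClosed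
  rintro x ⟨hx, hxj⟩
  obtain ⟨n, -, rfl⟩ := mem_iUnion₂.1 hx
  refine ⟨n, lt_of_not_ge fun hmn => hy n (K.skelSet_mono hmn ?_), rfl⟩
  exact CWComplex.closedCell_subset_skeleton m j hxj

theorem exists_incl_comp_eq {A : PtdSpace} [CompactSpace A] (h : Map A X) :
    ∃ n, ∃ k : Map A (K.skel n), (K.incl n).comp k = h := by
  obtain ⟨n, hn⟩ := exists_subset_of_isCompact_of_locallyFinite
    (fun _ => K.locallyFinite_singleton) (isCompact_range h.toFun.continuous)
  exact ⟨n, exists_comp_eq_of_range_subset IsEmbedding.subtypeVal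
    (hn.trans_eq Subtype.range_coe.symm)⟩

theorem suspMk_mem_range_suspMap_incl {n : ℕ} {p : X × I}
    (hp : p.1 ∈ K.skelSet n ∨ p ∈ suspBase X) :
    suspMk X p ∈ range (suspMap (K.incl n)).toFun := by
  rcases hp with hp | hp
  · exact ⟨suspMk (K.skel n) (⟨p.1, hp⟩, p.2), rfl⟩
  · exact ⟨(susp _).pt, (suspMap (K.incl n)).map_pt.trans (suspMk_eq_pt hp).symm⟩

theorem locallyFinite_singleton_susp {y : ℕ → susp X}
    (hy : ∀ n, y n ∉ range (suspMap (K.incl n)).toFun) :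
    LocallyFinite fun n => ({y n} : Set (susp X)) := by
  have := K.t2
  choose p hp using fun n => (isQuotientMap_suspMk X).surjective (y n)
  obtain rfl : (fun n => suspMk X (p n)) = y := funext hp
  have hskel (n : ℕ) : (p n).1 ∉ K.skelSet n :=
    fun h => hy n (K.suspMk_mem_range_suspMap_incl (Or.inl h))
  have hpreimage (n : ℕ) : suspMk X ⁻¹' {suspMk X (p n)} = {p n} :=
    suspMk_preimage_singleton fun h => hy n (K.suspMk_mem_range_suspMap_incl (Or.inr h))
  have hp_finite : LocallyFinite fun n => ({p n} : Set (X × I)) :=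
    ((K.locallyFinite_singleton hskel).preimage_continuous continuous_fst).subset fun n => by simp
  refine locallyFinite_of_isQuotientMap (isQuotientMap_suspMk X) ?_ fun n => ?_
  · simpa only [hpreimage] using hp_finite
  · rw [hpreimage]
    exact isClosed_singleton

theorem exists_suspMap_incl_comp_eq [T2Space (susp X)] {A : PtdSpace} [CompactSpace A]
    (h : Map A (susp X)) :
    ∃ n, ∃ k : Map A (susp (K.skel n)), (suspMap (K.incl n)).comp k = h := by
  obtain ⟨n, hn⟩ := exists_subset_of_isCompact_of_locallyFinite
    (fun _ => K.locallyFinite_singleton_susp) (isCompact_range h.toFun.continuous)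
  have hinj := suspMap_injective (f := K.incl n) Subtype.val_injective
  have hemb := ((suspMap (K.incl n)).toFun.continuous.isClosedEmbedding hinj).isEmbedding
  exact ⟨n, exists_comp_eq_of_range_subset hemb hn⟩

end Skeleta

section Phantom

variable {B Y V W : PtdSpace}

theorem phEqPoint_iff : K.PhEqPoint Y ↔ ∀ f : Map X Y, K.IsPhantom f → f.NullHomotopic := by
  have hconst : (const X Y).cls ∈ K.Ph Y := ⟨const X Y, fun _ => Homotopic.refl _, rfl⟩
  rw [PhEqPoint, eq_singleton_iff_unique_mem, and_iff_right hconst]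
  constructor
  · exact fun h f hf => cls_eq_cls.1 (h _ ⟨f, hf, rfl⟩)
  · rintro h _ ⟨f, hf, rfl⟩
    exact cls_eq_cls.2 (h f hf)

theorem relPhTrivial_iff {φ : Map B Y} :
    K.RelPhTrivial φ ↔ ∀ f : Map X Y, K.IsRelPhantom φ f → f.LiftsUpToHomotopy φ := by
  constructor
  · intro h f hf
    obtain ⟨g, hg, hgf⟩ := h _ ⟨f, hf, rfl⟩
    exact (cls_eq_cls.1 hgf).liftsUpToHomotopy_iff.1 hg
  · rintro h _ ⟨f, hf, rfl⟩
    exact ⟨f, h f hf, rfl⟩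

theorem relPhTrivial_iff_phEqPoint {φ : Map B Y} {α : Map Y V} {β : Map V W}
    (hφα : ∀ Z : PtdSpace.{u}, IsExactAt Z φ α) (hαβ : IsExactAt X α β)
    (hβ : β.NullHomotopic ∨ K.PhEqPoint W) : K.RelPhTrivial φ ↔ K.PhEqPoint V := by
  have isRelPhantom_iff (f : Map X Y) : K.IsRelPhantom φ f ↔ K.IsPhantom (α.comp f) :=
    forall_congr' fun n => (hφα (K.skel n) (f.comp (K.incl n))).symm
  have exists_comp_homotopic {g : Map X V} (hg : K.IsPhantom g) : g.LiftsUpToHomotopy α := by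
    refine (hαβ g).1 (hβ.elim (fun hβ => hβ.comp_right g) fun hW => ?_)
    exact K.phEqPoint_iff.1 hW _ fun n => (hg n).comp_left β
  simp only [K.relPhTrivial_iff, K.phEqPoint_iff, isRelPhantom_iff, ← hφα X _]
  refine ⟨fun h g hg => ?_, fun h f hf => h _ hf⟩
  obtain ⟨f, hf⟩ := exists_comp_homotopic hg
  have hph : K.IsPhantom (α.comp f) :=
    fun n => (hf.comp_right (K.incl n)).nullHomotopic_iff.2 (hg n)
  exact hf.nullHomotopic_iff.1 (h f hph)

theorem isRelPhantom_susp_iff (L : CWStructure (susp X)) {φ : Map B Y} {f : Map (susp X) Y} :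
    L.IsRelPhantom φ f ↔ ∀ n, (f.comp (suspMap (K.incl n))).LiftsUpToHomotopy φ := by
  have := L.t2
  constructor
  · intro h n
    obtain ⟨m, k, hk⟩ := L.exists_incl_comp_eq (suspMap (K.incl n))
    rw [← hk]
    exact (h m).comp_right k
  · intro h n
    obtain ⟨m, k, hk⟩ := K.exists_suspMap_incl_comp_eq (L.incl n)
    rw [← hk]
    exact (h m).comp_right k

theorem isRelPhantom_loopMap_iff (L : CWStructure (susp X)) {φ : Map B Y} {f : Map (susp X) Y} :
    K.IsRelPhantom (loopMap φ) (suspLoopEquiv f) ↔ L.IsRelPhantom φ f := by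
  rw [K.isRelPhantom_susp_iff L]
  simp only [IsRelPhantom, ← suspLoopEquiv_comp_suspMap, suspLoopEquiv_liftsUpToHomotopy_iff]

theorem relPhTrivial_loopMap_iff (L : CWStructure (susp X)) {φ : Map B Y} :
    K.RelPhTrivial (loopMap φ) ↔ L.RelPhTrivial φ := by
  simp only [relPhTrivial_iff, suspLoopEquiv.surjective.forall, K.isRelPhantom_loopMap_iff L,
    suspLoopEquiv_liftsUpToHomotopy_iff]

end Phantom

end CWStructure

end PtdSpace

open PtdSpace in
theorem proposition4p7 (X : PtdSpace) (K : CWStructure X) :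
    (∀ (B Y V W : PtdSpace) (φ : Map B Y) (α : Map Y V) (β : Map V W),
      IsHomotopyFibration φ α → IsHomotopyFibration α β →
      (β.NullHomotopic ∨ K.PhEqPoint W) →
      (K.RelPhTrivial φ ↔ K.PhEqPoint V)) ∧
    (∀ (L : CWStructure (susp X)) (F B Y : PtdSpace) (j : Map F B) (φ : Map B Y),
      IsHomotopyFibration j φ →
      (j.NullHomotopic ∨ K.PhEqPoint B) →
      (L.RelPhTrivial φ ↔ K.PhEqPoint F)) := by
  constructor
  · intro B Y V W φ α β hφα hαβ hβ
    exact K.relPhTrivial_iff_phEqPoint (fun _ => hφα.isExactAt) hαβ.isExactAt hβ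
  · intro L F B Y j φ hjφ hj
    obtain ⟨δ, hδ⟩ := hjφ.exists_connecting_map
    calc L.RelPhTrivial φ ↔ K.RelPhTrivial (loopMap φ) := (K.relPhTrivial_loopMap_iff L).symm
      _ ↔ K.PhEqPoint F := K.relPhTrivial_iff_phEqPoint (fun Z => (hδ Z).1) (hδ X).2 hj
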